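/- Let $N, M > 1$ and let $A$ and $B$ be an $N\times N$ and an $M\times M$ matrix with entries in $\{0,1\}$, both irreducible and satisfying condition (I) of Cuntz and Krieger (from every state there is a path to a state at which there are two distinct first-return loops). Let $X_A=\{(x_n)_{n\in\mathbb N}\in\{1,\dots,N\}^{\mathbb N} : A(x_n,x_{n+1})=1 \text{ for all } n\}$ with the product topology and the shift $\sigma_A((x_n)_n)=(x_{n+1})_n$, let $\bar X_A$ be the analogous space of two-sided sequences $(x_n)_{n\in\mathbb Z}$ with the shift homeomorphism $\bar\sigma_A$, and let $\bar\sigma_A^*$ be the automorphism $f\mapsto f\circ\bar\sigma_A^{-1}$ of the $C^*$-algebra $C(\bar X_A)$ of complex-valued continuous functions on $\bar X_A$; similarly for $B$. Suppose that the one-sided topological Markov shifts $(X_A,\sigma_A)$ and $(X_B,\sigma_B)$ are strongly continuous orbit equivalent, that is, there is a homeomorphism $h:X_A\to X_B$ for which there are continuous functions $k_1,l_1:X_A\to\mathbb Z_{\ge 0}$, $b_1:X_A\to\mathbb Z$ and $k_2,l_2:X_B\to\mathbb Z_{\ge 0}$, $b_2:X_B\to\mathbb Z$ such that $$\sigma_B^{k_1(x)}(h(\sigma_A(x)))=\sigma_B^{l_1(x)}(h(x)),\qquad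 l_1(x)-k_1(x)=1+b_1(x)-b_1(\sigma_A(x))\qquad (x\in X_A),$$ $$\sigma_A^{k_2(y)}(h^{-1}(\sigma_B(y)))=\sigma_A^{l_2(y)}(h^{-1}(y)),\qquad l_2(y)-k_2(y)=1+b_2(y)-b_2(\sigma_B(y))\qquad (y\in X_B).$$ Then the $C^*$-crossed products are isomorphic as $C^*$-algebras: $$C(\bar X_A)\rtimes_{\bar\sigma_A^*}\mathbb Z\;\cong\;C(\bar X_B)\rtimes_{\bar\sigma_B^*}\mathbb Z.$$ -/

import Mathlib

open Topology Set
open scoped ENNReal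

/-! ### Topological Markov shifts -/

section Shifts

/-- A *return word* of `A` at the state `i`: a word `v` avoiding `i` such that `i v i` is
admissible, so that `i v i` is a loop at `i` which meets `i` only at its two ends. -/
def IsReturnWord {N : ℕ} (A : Matrix (Fin N) (Fin N) ℤ) (i : Fin N) (v : List (Fin N)) : Prop :=
  i ∉ v ∧ List.IsChain (fun a b => A a b = 1) (i :: (v ++ [i]))

/-- Condition (I) of Cuntz and Krieger: from every state `i` there is a path (possibly of length
zero) to a state `j` which has two distinct return words. -/
def ConditionI {N : ℕ} (A : Matrix (Fin N) (Fin N) ℤ) : Prop :=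
  ∀ i, ∃ j, Relation.ReflTransGen (fun a b => A a b = 1) i j ∧
    ∃ v w, v ≠ w ∧ IsReturnWord A j v ∧ IsReturnWord A j w

/-- The one-sided shift space `X_A`, with coordinates indexed by `0, 1, 2, …`; it carries the
subspace topology of the product topology. -/
def OneSidedShift {N : ℕ} (A : Matrix (Fin N) (Fin N) ℤ) : Set (ℕ → Fin N) :=
  {x | ∀ n, A (x n) (x (n + 1)) = 1}

/-- The shift transformation `σ_A` of `X_A`. -/
def oneSidedShiftMap {N : ℕ} (A : Matrix (Fin N) (Fin N) ℤ) (x : OneSidedShift A) :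
    OneSidedShift A :=
  ⟨fun n => x.1 (n + 1), fun n => x.2 (n + 1)⟩

/-- The two-sided shift space `X̄_A`, with the subspace topology of the product topology. -/
def TwoSidedShift {N : ℕ} (A : Matrix (Fin N) (Fin N) ℤ) : Set (ℤ → Fin N) :=
  {x | ∀ n, A (x n) (x (n + 1)) = 1}

/-- The shift homeomorphism `σ̄_A` of `X̄_A`. -/
def twoSidedShiftHomeo {N : ℕ} (A : Matrix (Fin N) (Fin N) ℤ) :
    TwoSidedShift A ≃ₜ TwoSidedShift A where
  toFun x := ⟨fun n => x.1 (n + 1), fun n => x.2 (n + 1)⟩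
  invFun x := ⟨fun n => x.1 (n - 1), fun n => by
    have h := x.2 (n - 1)
    rwa [show n - 1 + 1 = n + 1 - 1 by ring] at h⟩
  left_inv x := by ext n; simp
  right_inv x := by ext n; simp
  continuous_toFun := by
    refine Continuous.subtype_mk (continuous_pi fun n => ?_) _
    exact (continuous_apply (n + 1)).comp continuous_subtype_val
  continuous_invFun := by
    refine Continuous.subtype_mk (continuous_pi fun n => ?_) _
    exact (continuous_apply (n - 1)).comp continuous_subtype_val

theorem isClosed_twoSidedShift {N : ℕ} (A : Matrix (Fin N) (Fin N) ℤ) :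
    IsClosed (TwoSidedShift A) := by
  rw [show TwoSidedShift A = ⋂ n : ℤ, {x | A (x n) (x (n + 1)) = 1} by
    ext x; simp [TwoSidedShift]]
  refine isClosed_iInter fun n => ?_
  have hc : Continuous fun x : ℤ → Fin N => (x n, x (n + 1)) := by fun_prop
  exact (isClosed_discrete {p : Fin N × Fin N | A p.1 p.2 = 1}).preimage hc

instance instCompactSpaceTwoSidedShift {N : ℕ} (A : Matrix (Fin N) (Fin N) ℤ) :
    CompactSpace (TwoSidedShift A) :=
  isCompact_iff_compactSpace.mp (isClosed_twoSidedShift A).isCompact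

end Shifts

/-! ### Strongly continuous orbit equivalence -/

section OrbitEquivalence

/-- `k, l : X_A → ℤ₊` are continuous and `σ_B^{k(x)} (h (σ_A x)) = σ_B^{l(x)} (h x)`. -/
def IsOrbitPair {N M : ℕ} (A : Matrix (Fin N) (Fin N) ℤ) (B : Matrix (Fin M) (Fin M) ℤ)
    (h : OneSidedShift A → OneSidedShift B) (k l : OneSidedShift A → ℕ) : Prop :=
  Continuous k ∧ Continuous l ∧
    ∀ x, (oneSidedShiftMap B)^[k x] (h (oneSidedShiftMap A x)) = (oneSidedShiftMap B)^[l x] (h x)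

/-- Continuous orbit maps `(X_A, σ_A) → (X_B, σ_B)`. -/
def IsContinuousOrbitMap {N M : ℕ} (A : Matrix (Fin N) (Fin N) ℤ) (B : Matrix (Fin M) (Fin M) ℤ)
    (h : OneSidedShift A → OneSidedShift B) : Prop :=
  IsLocalHomeomorph h ∧ ∃ k l, IsOrbitPair A B h k l

/-- `Ψ_h(f)(x) = ∑_{i < l(x)} f(σ_B^i (h x)) - ∑_{j < k(x)} f(σ_B^j (h (σ_A x)))`. -/
def orbitPullback {N M : ℕ} (A : Matrix (Fin N) (Fin N) ℤ) (B : Matrix (Fin M) (Fin M) ℤ)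
    (h : OneSidedShift A → OneSidedShift B) (k l : OneSidedShift A → ℕ)
    (f : OneSidedShift B → ℤ) (x : OneSidedShift A) : ℤ :=
  ∑ i ∈ Finset.range (l x), f ((oneSidedShiftMap B)^[i] (h x)) -
    ∑ j ∈ Finset.range (k x), f ((oneSidedShiftMap B)^[j] (h (oneSidedShiftMap A x)))

/-- Strongly continuous orbit maps: continuous orbit maps `h` for which `Ψ_h(1)` is cohomologous
to `1`, that is `Ψ_h(1) = 1 + b - b ∘ σ_A` with `b : X_A → ℤ` continuous. -/
def IsStronglyContinuousOrbitMap {N M : ℕ} (A : Matrix (Fin N) (Fin N) ℤ)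
    (B : Matrix (Fin M) (Fin M) ℤ) (h : OneSidedShift A → OneSidedShift B) : Prop :=
  IsLocalHomeomorph h ∧ ∃ k l, IsOrbitPair A B h k l ∧
    ∃ b : OneSidedShift A → ℤ, Continuous b ∧
      ∀ x, orbitPullback A B h k l (fun _ => 1) x = 1 + b x - b (oneSidedShiftMap A x)

/-- Continuous orbit homeomorphisms. -/
def IsContinuousOrbitHomeo {N M : ℕ} (A : Matrix (Fin N) (Fin N) ℤ)
    (B : Matrix (Fin M) (Fin M) ℤ) (h : OneSidedShift A ≃ₜ OneSidedShift B) : Prop :=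
  IsContinuousOrbitMap A B h ∧ IsContinuousOrbitMap B A h.symm

/-- Strongly continuous orbit homeomorphisms. -/
def IsStronglyContinuousOrbitHomeo {N M : ℕ} (A : Matrix (Fin N) (Fin N) ℤ)
    (B : Matrix (Fin M) (Fin M) ℤ) (h : OneSidedShift A ≃ₜ OneSidedShift B) : Prop :=
  IsContinuousOrbitHomeo A B h ∧ IsStronglyContinuousOrbitMap A B h

/-- Strong continuous orbit equivalence of `(X_A, σ_A)` and `(X_B, σ_B)`. -/
def StronglyContinuousOrbitEquivalent {N M : ℕ} (A : Matrix (Fin N) (Fin N) ℤ)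
    (B : Matrix (Fin M) (Fin M) ℤ) : Prop :=
  ∃ h : OneSidedShift A ≃ₜ OneSidedShift B,
    IsStronglyContinuousOrbitHomeo A B h ∧ IsStronglyContinuousOrbitHomeo B A h.symm

end OrbitEquivalence

/-! ### Crossed products by `ℤ` -/

noncomputable section CrossedProduct

universe u

/-- A covariant representation of `(𝒜, α, ℤ)`, for an automorphism `α` of a unital C*-algebra `𝒜`:
a unital *-representation `π` of `𝒜` on a nonzero Hilbert space `H` and a unitary `U` on `H` with
`U π(a) U* = π(α a)`. -/
structure CovariantRep {𝒜 : Type u} [CStarAlgebra 𝒜] (α : 𝒜 ≃⋆ₐ[ℂ] 𝒜) : Type (u + 1) where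
  /-- The Hilbert space. -/
  H : Type u
  [normed : NormedAddCommGroup H]
  [inner : InnerProductSpace ℂ H]
  [complete : CompleteSpace H]
  [nontrivial : Nontrivial H]
  /-- The representation of the algebra. -/
  π : 𝒜 →⋆ₐ[ℂ] (H →L[ℂ] H)
  /-- The unitary which implements the automorphism. -/
  U : unitary (H →L[ℂ] H)
  covariant : ∀ a, (U : H →L[ℂ] H) * π a * star (U : H →L[ℂ] H) = π (α a)

attribute [instance] CovariantRep.normed CovariantRep.inner CovariantRep.complete
  CovariantRep.nontrivial

/-- The C*-algebra `∏_ρ B(H_ρ)` of bounded families of operators, over all covariant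
representations `ρ`, with the supremum norm. -/
abbrev CovariantFamily {𝒜 : Type u} [CStarAlgebra 𝒜] (α : 𝒜 ≃⋆ₐ[ℂ] 𝒜) : Type (u + 1) :=
  lp (fun ρ : CovariantRep α => ρ.H →L[ℂ] ρ.H) ∞

instance instCStarAlgebraCovariantFamily {𝒜 : Type u} [CStarAlgebra 𝒜] (α : 𝒜 ≃⋆ₐ[ℂ] 𝒜) :
    CStarAlgebra (CovariantFamily α) where

/-- The family `(π_ρ(a))_ρ`. -/
def universalRep {𝒜 : Type u} [CStarAlgebra 𝒜] (α : 𝒜 ≃⋆ₐ[ℂ] 𝒜) (a : 𝒜) : CovariantFamily α :=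
  ⟨fun ρ => ρ.π a, memℓp_infty ⟨‖a‖, by
    rintro _ ⟨ρ, rfl⟩
    exact NonUnitalStarAlgHom.norm_apply_le ρ.π a⟩⟩

/-- The family `(U_ρ)_ρ`. -/
def universalUnitary {𝒜 : Type u} [CStarAlgebra 𝒜] (α : 𝒜 ≃⋆ₐ[ℂ] 𝒜) : CovariantFamily α :=
  ⟨fun ρ => (ρ.U : ρ.H →L[ℂ] ρ.H), memℓp_infty ⟨1, by
    rintro _ ⟨ρ, rfl⟩
    exact CStarRing.norm_coe_unitary ρ.U |>.le⟩⟩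

/-- The C*-subalgebra generated by the families `(π_ρ(a))_ρ`, `a ∈ 𝒜`, and `(U_ρ)_ρ`. -/
def crossedProductSubalgebra {𝒜 : Type u} [CStarAlgebra 𝒜] (α : 𝒜 ≃⋆ₐ[ℂ] 𝒜) :
    StarSubalgebra ℂ (CovariantFamily α) :=
  (StarAlgebra.adjoin ℂ (range (universalRep α) ∪ {universalUnitary α})).topologicalClosure

/-- The (full) C*-crossed product `𝒜 ⋊_α ℤ`: the C*-algebra generated by the copy of `𝒜` and the
implementing unitary in the direct sum of all covariant representations. In other words, it is the
completion of the twisted convolution algebra of finite sums `∑ a_n u^n` in the norm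
`‖x‖ = sup_ρ ‖(π_ρ × U_ρ)(x)‖`. -/
def CrossedProduct {𝒜 : Type u} [CStarAlgebra 𝒜] (α : 𝒜 ≃⋆ₐ[ℂ] 𝒜) : Type (u + 1) :=
  crossedProductSubalgebra α

instance instCStarAlgebraCrossedProduct {𝒜 : Type u} [CStarAlgebra 𝒜] (α : 𝒜 ≃⋆ₐ[ℂ] 𝒜) :
    CStarAlgebra (CrossedProduct α) :=
  StarSubalgebra.cstarAlgebra (crossedProductSubalgebra α)
    (h_closed := StarSubalgebra.isClosed_topologicalClosure _)

/-- The automorphism `σ̄_A^*(f) = f ∘ σ̄_A⁻¹` of `C(X̄_A)`. -/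
def twoSidedShiftAut {N : ℕ} (A : Matrix (Fin N) (Fin N) ℤ) :
    C(TwoSidedShift A, ℂ) ≃⋆ₐ[ℂ] C(TwoSidedShift A, ℂ) :=
  (twoSidedShiftHomeo A).symm.compStarAlgEquiv' ℂ ℂ

end CrossedProduct

/-! ### Conjugacy of the two-sided shifts -/

section Conjugacy

variable {N M : ℕ} {A : Matrix (Fin N) (Fin N) ℤ} {B : Matrix (Fin M) (Fin M) ℤ}

/-! Strong continuous orbit equivalence already makes the two-sided shifts conjugate, and conjugate
systems have isomorphic crossed products. Since `l - k` is `1` up to the coboundary of `b`, the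
sequences `h (σ^m x)`, each re-indexed by its own value of `b`, agree far to the right
(`IsOrbitCocycle.apply_iterate`). Hence, for a two-sided `x`, the images under `h` of its right rays
from `n`, placed at `n - b`, fit together as `n → -∞` into one two-sided sequence. This gives a
continuous shift-commuting map `twoSidedMap`. The maps built from `h` and `h⁻¹` compose to a power
of the shift on each point (`exists_twoSidedMap_twoSidedMap`), which forces bijectivity, and
compactness gives a homeomorphism. -/

theorem oneSidedShiftMap_iterate_apply (x : OneSidedShift A) (m i : ℕ) :
    ((oneSidedShiftMap A)^[m] x).1 i = x.1 (i + m) := by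
  induction m generalizing x with
  | zero => rfl
  | succ m ih =>
    rw [Function.iterate_succ_apply, ih]
    exact congrArg x.1 (by omega)

/-- A map `h` of one-sided shifts together with functions witnessing that it respects orbits, with
a cocycle cohomologous to `1`; the bound `D` controls where the images of the successive tails of
a point agree. -/
structure IsOrbitCocycle (h : OneSidedShift A → OneSidedShift B) (k l : OneSidedShift A → ℕ)
    (b : OneSidedShift A → ℤ) (D : ℤ) : Prop where
  continuous_map : Continuous h
  continuous_potential : Continuous b
  orbit : ∀ x,
    (oneSidedShiftMap B)^[k x] (h (oneSidedShiftMap A x)) = (oneSidedShiftMap B)^[l x] (h x)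
  cocycle : ∀ x, (l x : ℤ) - k x = 1 + b x - b (oneSidedShiftMap A x)
  bound : ∀ x, (l x : ℤ) - b x ≤ D

instance compactSpace_oneSidedShift (A : Matrix (Fin N) (Fin N) ℤ) :
    CompactSpace (OneSidedShift A) := by
  refine isCompact_iff_compactSpace.mp (IsClosed.isCompact ?_)
  rw [show OneSidedShift A = ⋂ n : ℕ, {x | A (x n) (x (n + 1)) = 1} by
    ext x; simp [OneSidedShift]]
  refine isClosed_iInter fun n => ?_
  have hc : Continuous fun x : ℕ → Fin N => (x n, x (n + 1)) := by fun_prop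
  exact (isClosed_discrete {p : Fin N × Fin N | A p.1 p.2 = 1}).preimage hc

theorem IsStronglyContinuousOrbitMap.exists_isOrbitCocycle
    {h : OneSidedShift A → OneSidedShift B} (hh : IsStronglyContinuousOrbitMap A B h) :
    ∃ k l b D, IsOrbitCocycle h k l b D := by
  obtain ⟨hloc, k, l, ⟨-, hl, horb⟩, b, hb, hcob⟩ := hh
  have hc : Continuous fun x => (l x : ℤ) - b x :=
    (continuous_of_discreteTopology.comp hl).sub hb
  obtain ⟨D, hD⟩ := (isCompact_range hc).bddAbove
  refine ⟨k, l, b, D, hloc.continuous, hb, horb, fun x => ?_, fun x => hD ⟨x, rfl⟩⟩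
  simpa [orbitPullback] using hcob x

/-- Reading the images of the shifts of `x` at the position corrected by the potential gives the
same symbol. -/
theorem IsOrbitCocycle.apply_iterate {h : OneSidedShift A → OneSidedShift B}
    {k l : OneSidedShift A → ℕ} {b : OneSidedShift A → ℤ} {D : ℤ}
    (H : IsOrbitCocycle h k l b D) (x : OneSidedShift A) (m : ℕ) (j : ℤ) (hj : m + D ≤ j) :
    (h ((oneSidedShiftMap A)^[m] x)).1 (j - m + b ((oneSidedShiftMap A)^[m] x)).toNat =
      (h x).1 (j + b x).toNat := by
  induction m with
  | zero => simp
  | succ m ih =>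
    rw [← ih (by push_cast at hj; omega), Function.iterate_succ_apply']
    generalize (oneSidedShiftMap A)^[m] x = y
    have hy := H.cocycle y
    have hD := H.bound y
    -- The orbit identity at `y` is read at coordinate `j - m + b y - l y`, nonnegative by
    -- `H.bound`. Adding `l y` gives the index for `y`; adding `k y` gives, by the cocycle identity,
    -- the index for its shift.
    have ho := congrArg (fun z => z.1 (j - m + b y - l y).toNat) (H.orbit y)
    simp only [oneSidedShiftMap_iterate_apply] at ho
    push_cast at hj ⊢
    convert ho using 2 <;> omega

/-- The one-sided sequence of the coordinates `n, n + 1, …` of a two-sided sequence. -/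
def rightRay (x : TwoSidedShift A) (n : ℤ) : OneSidedShift A :=
  ⟨fun i => x.1 (n + i), fun i => by
    have := x.2 (n + i)
    rwa [show n + (i : ℤ) + 1 = n + ((i + 1 : ℕ) : ℤ) by push_cast; ring] at this⟩

theorem continuous_rightRay (n : ℤ) : Continuous fun x : TwoSidedShift A => rightRay x n := by
  refine Continuous.subtype_mk (continuous_pi fun i => ?_) _
  exact (continuous_apply (n + (i : ℤ))).comp continuous_subtype_val

theorem oneSidedShiftMap_iterate_rightRay (x : TwoSidedShift A) (n : ℤ) (m : ℕ) :
    (oneSidedShiftMap A)^[m] (rightRay x n) = rightRay x (n + m) := by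
  refine Subtype.ext (funext fun i => ?_)
  rw [oneSidedShiftMap_iterate_apply]
  refine congrArg x.1 ?_
  push_cast
  ring

/-- The `d`-th power of the shift of a two-sided shift space. -/
def shiftBy (d : ℤ) (x : TwoSidedShift A) : TwoSidedShift A :=
  ⟨fun n => x.1 (n + d), fun n => by
    have := x.2 (n + d)
    rwa [show n + d + 1 = n + 1 + d by ring] at this⟩

theorem shiftBy_shiftBy (d e : ℤ) (x : TwoSidedShift A) :
    shiftBy d (shiftBy e x) = shiftBy (d + e) x := by
  exact Subtype.ext (funext fun n => congrArg x.1 (add_assoc n d e))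

theorem shiftBy_zero (x : TwoSidedShift A) : shiftBy 0 x = x := by
  exact Subtype.ext (funext fun n => congrArg x.1 (add_zero n))

theorem rightRay_shiftBy (d : ℤ) (x : TwoSidedShift A) (n : ℤ) :
    rightRay (shiftBy d x) n = rightRay x (n + d) := by
  exact Subtype.ext (funext fun i => congrArg x.1 (add_right_comm n (i : ℤ) d))

namespace IsOrbitCocycle

variable {h : OneSidedShift A → OneSidedShift B} {k l : OneSidedShift A → ℕ}
  {b : OneSidedShift A → ℤ} {D : ℤ}

theorem apply_rightRay (H : IsOrbitCocycle h k l b D) (x : TwoSidedShift A) {n j : ℤ}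
    (hn : n + D ≤ j) :
    (h (rightRay x (j - D))).1 (D + b (rightRay x (j - D))).toNat =
      (h (rightRay x n)).1 (j - n + b (rightRay x n)).toNat := by
  obtain ⟨m, hm⟩ := Int.eq_ofNat_of_zero_le (show 0 ≤ j - D - n by omega)
  rw [← H.apply_iterate (rightRay x n) m (j - n) (by omega), oneSidedShiftMap_iterate_rightRay]
  rw [show n + (m : ℤ) = j - D by omega, show j - n - (m : ℤ) = D by omega]

/-- The map of two-sided shifts induced by an orbit cocycle: far to the right of `n` it is the
image of the ray of `x` from `n` on, placed at the position `n - b`. -/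
def twoSidedMap (H : IsOrbitCocycle h k l b D) (x : TwoSidedShift A) : TwoSidedShift B :=
  ⟨fun j => (h (rightRay x (j - D))).1 (D + b (rightRay x (j - D))).toNat, fun j => by
    have hD := H.bound (rightRay x (j - D))
    beta_reduce
    -- Coordinates `j` and `j + 1` are both read off the image of the ray from `j - D`. There `D + b
    -- ≥ l ≥ 0`, so `toNat` does not truncate.
    rw [H.apply_rightRay x (n := j - D) (j := j + 1) (by omega)]
    have := (h (rightRay x (j - D))).2 (D + b (rightRay x (j - D))).toNat
    rwa [show (D + b (rightRay x (j - D))).toNat + 1 =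
      (j + 1 - (j - D) + b (rightRay x (j - D))).toNat by omega] at this⟩

theorem twoSidedMap_apply (H : IsOrbitCocycle h k l b D) (x : TwoSidedShift A) {n j : ℤ}
    (hn : n + D ≤ j) :
    (H.twoSidedMap x).1 j = (h (rightRay x n)).1 (j - n + b (rightRay x n)).toNat :=
  H.apply_rightRay x hn

theorem rightRay_twoSidedMap (H : IsOrbitCocycle h k l b D) (x : TwoSidedShift A) {n m : ℤ}
    (hn : n + D ≤ m) :
    rightRay (H.twoSidedMap x) m =
      (oneSidedShiftMap B)^[(m - n + b (rightRay x n)).toNat] (h (rightRay x n)) := by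
  refine Subtype.ext (funext fun i => ?_)
  rw [oneSidedShiftMap_iterate_apply]
  have hD := H.bound (rightRay x n)
  refine (H.twoSidedMap_apply x (n := n) (by omega)).trans (congrArg (h (rightRay x n)).1 ?_)
  omega

theorem twoSidedMap_shiftBy (H : IsOrbitCocycle h k l b D) (d : ℤ) (x : TwoSidedShift A) :
    H.twoSidedMap (shiftBy d x) = shiftBy d (H.twoSidedMap x) := by
  refine Subtype.ext (funext fun j => ?_)
  change (h (rightRay (shiftBy d x) (j - D))).1 (D + b (rightRay (shiftBy d x) (j - D))).toNat =
    (h (rightRay x (j + d - D))).1 (D + b (rightRay x (j + d - D))).toNat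
  rw [rightRay_shiftBy, show j - D + d = j + d - D by ring]

theorem continuous_twoSidedMap (H : IsOrbitCocycle h k l b D) : Continuous H.twoSidedMap := by
  refine Continuous.subtype_mk (continuous_pi fun j => ?_) _
  have heval : Continuous fun p : (ℕ → Fin M) × ℕ => p.1 p.2 :=
    continuous_prod_of_discrete_right.2 fun i => continuous_apply i
  have hr := continuous_rightRay (A := A) (j - D)
  have hi : Continuous fun z : ℤ => (D + z).toNat := continuous_of_discreteTopology
  exact heval.comp ((continuous_subtype_val.comp (H.continuous_map.comp hr)).prodMk
    (hi.comp (H.continuous_potential.comp hr)))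

variable {g : OneSidedShift B → OneSidedShift A} {k' l' : OneSidedShift B → ℕ}
  {b' : OneSidedShift B → ℤ} {D' : ℤ}

/-- Seen from the ray at `n`, the composite undoes `h` and leaves a displacement by the two
potentials, valid at all coordinates from `n + D + D'` on. -/
theorem exists_twoSidedMap_twoSidedMap (H : IsOrbitCocycle h k l b D)
    (G : IsOrbitCocycle g k' l' b' D') (hgh : Function.LeftInverse g h) (x : TwoSidedShift A) :
    ∃ d, G.twoSidedMap (H.twoSidedMap x) = shiftBy d x := by
  have key : ∀ q n : ℤ, n + D + D' ≤ q → (G.twoSidedMap (H.twoSidedMap x)).1 q =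
      x.1 (q + (b (rightRay x n) + b' (h (rightRay x n)))) := by
    intro q n hq
    have hD := H.bound (rightRay x n)
    have hD' := G.bound (h (rightRay x n))
    rw [G.twoSidedMap_apply _ (n := n + D) hq, H.rightRay_twoSidedMap x le_rfl]
    have := G.apply_iterate (h (rightRay x n)) (n + D - n + b (rightRay x n)).toNat
      (q - n + b (rightRay x n)) (by omega)
    rw [show q - n + b (rightRay x n) - ((n + D - n + b (rightRay x n)).toNat : ℤ) =
      q - (n + D) by omega] at this
    rw [this, hgh]
    refine congrArg x.1 ?_
    omega
  have hc : Continuous fun y => b y + b' (h y) :=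
    H.continuous_potential.add (G.continuous_potential.comp H.continuous_map)
  have : Finite (range fun y => b y + b' (h y)) := (isCompact_range hc).finite_of_discrete
  -- The displacement takes finitely many values, so one value `d` occurs for starts `-t`
  -- arbitrarily far to the left, and these reach every coordinate.
  obtain ⟨⟨d, _⟩, hd⟩ := Finite.exists_infinite_fiber (rangeFactorization
    (fun y => b y + b' (h y)) ∘ fun t : ℕ => rightRay x (-t))
  refine ⟨d, ?_⟩
  refine Subtype.ext (funext fun q => ?_)
  obtain ⟨t, ht, hlt⟩ := (Set.infinite_coe_iff.1 hd).exists_gt (D + D' - q).toNat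
  have ht' : b (rightRay x (-t)) + b' (h (rightRay x (-t))) = d := congrArg Subtype.val ht
  rw [key q (-t) (by omega), ht']
  rfl

/-- The exponent `d` depends on the point, so the composite is not visibly injective. But points
with equal image lie in one shift orbit, and equivariance then shows that the shift relating them
fixes the point. -/
theorem bijective_twoSidedMap (H : IsOrbitCocycle h k l b D) (G : IsOrbitCocycle g k' l' b' D')
    (hgh : Function.LeftInverse g h) (hhg : Function.RightInverse g h) :
    Function.Bijective H.twoSidedMap := by
  constructor
  · intro x x' hxx'
    obtain ⟨d, hd⟩ := exists_twoSidedMap_twoSidedMap H G hgh x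
    obtain ⟨d', hd'⟩ := exists_twoSidedMap_twoSidedMap H G hgh x'
    have h1 : x' = shiftBy (d - d') x := by
      rw [← hxx', hd] at hd'
      have := congrArg (shiftBy (-d')) hd'
      rw [shiftBy_shiftBy, shiftBy_shiftBy, neg_add_cancel, shiftBy_zero] at this
      rw [← this, neg_add_eq_sub]
    have h2 := congrArg G.twoSidedMap hxx'
    rw [h1, twoSidedMap_shiftBy, twoSidedMap_shiftBy, hd, shiftBy_shiftBy] at h2
    have h3 := congrArg (shiftBy (-d)) h2
    rw [shiftBy_shiftBy, shiftBy_shiftBy, neg_add_cancel, shiftBy_zero] at h3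
    rw [h1]
    convert h3 using 2
    ring
  · intro z
    obtain ⟨d, hd⟩ := exists_twoSidedMap_twoSidedMap G H hhg z
    refine ⟨shiftBy (-d) (G.twoSidedMap z), ?_⟩
    rw [twoSidedMap_shiftBy, hd, shiftBy_shiftBy, neg_add_cancel, shiftBy_zero]

end IsOrbitCocycle

/-- Strongly continuous orbit equivalent one-sided shifts have topologically conjugate two-sided
shifts. -/
theorem StronglyContinuousOrbitEquivalent.exists_conjugacy
    (hAB : StronglyContinuousOrbitEquivalent A B) :
    ∃ φ : TwoSidedShift A ≃ₜ TwoSidedShift B,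
      ∀ x, φ (twoSidedShiftHomeo A x) = twoSidedShiftHomeo B (φ x) := by
  obtain ⟨h, ⟨-, hh⟩, ⟨-, hg⟩⟩ := hAB
  obtain ⟨k, l, b, D, H⟩ := hh.exists_isOrbitCocycle
  obtain ⟨k', l', b', D', G⟩ := hg.exists_isOrbitCocycle
  have hbij := H.bijective_twoSidedMap G h.symm_apply_apply h.apply_symm_apply
  exact ⟨Continuous.homeoOfEquivCompactToT2 (f := Equiv.ofBijective _ hbij)
    H.continuous_twoSidedMap, fun x => H.twoSidedMap_shiftBy 1 x⟩

end Conjugacy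

/-! ### Functoriality of the crossed product -/

noncomputable section CrossedProductFunctoriality

universe u

variable {𝒜 ℬ : Type u} [CStarAlgebra 𝒜] [CStarAlgebra ℬ] {α : 𝒜 ≃⋆ₐ[ℂ] 𝒜} {β : ℬ ≃⋆ₐ[ℂ] ℬ}

/-- The pullback of a covariant representation along an equivariant isomorphism. -/
def CovariantRep.comap (θ : 𝒜 ≃⋆ₐ[ℂ] ℬ) (hθ : ∀ a, θ (α a) = β (θ a)) (ρ : CovariantRep β) :
    CovariantRep α where
  H := ρ.H
  π := ρ.π.comp (θ : 𝒜 →⋆ₐ[ℂ] ℬ)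
  U := ρ.U
  covariant a := by
    change _ * ρ.π (θ a) * _ = ρ.π (θ (α a))
    rw [hθ, ρ.covariant]

/-- Reindexing of families of operators along an equivariant isomorphism. -/
def CovariantFamily.reindex (θ : 𝒜 ≃⋆ₐ[ℂ] ℬ) (hθ : ∀ a, θ (α a) = β (θ a)) :
    CovariantFamily α →⋆ₐ[ℂ] CovariantFamily β where
  toFun f := ⟨fun ρ => f (ρ.comap θ hθ), memℓp_infty ⟨‖f‖, by
    rintro _ ⟨ρ, rfl⟩
    exact lp.norm_apply_le_norm ENNReal.top_ne_zero f (ρ.comap θ hθ)⟩⟩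
  map_one' := rfl
  map_mul' _ _ := rfl
  map_zero' := rfl
  map_add' _ _ := rfl
  commutes' _ := rfl
  map_star' _ := rfl

theorem CovariantFamily.reindex_reindex (θ : 𝒜 ≃⋆ₐ[ℂ] ℬ) (hθ : ∀ a, θ (α a) = β (θ a))
    (hθ' : ∀ b, θ.symm (β b) = α (θ.symm b)) (f : CovariantFamily α) :
    reindex θ.symm hθ' (reindex θ hθ f) = f := by
  -- Pulling back twice keeps `H` and `U` definitionally but changes `π` to a merely equal map. As
  -- `f` is a dependent family, `π'` is kept a variable so that the equality can be substituted.
  have key : ∀ (ρ : CovariantRep α) (π' : 𝒜 →⋆ₐ[ℂ] (ρ.H →L[ℂ] ρ.H)) (_ : π' = ρ.π)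
      (hc : ∀ a, (ρ.U : ρ.H →L[ℂ] ρ.H) * π' a * star (ρ.U : ρ.H →L[ℂ] ρ.H) = π' (α a)),
      f { H := ρ.H, π := π', U := ρ.U, covariant := hc } = f ρ := by
    rintro ρ _ rfl hc
    rfl
  ext1
  funext ρ
  refine key ρ _ ?_ _
  ext1 a
  exact congrArg ρ.π (θ.symm_apply_apply a)

theorem CovariantFamily.reindex_mem (θ : 𝒜 ≃⋆ₐ[ℂ] ℬ) (hθ : ∀ a, θ (α a) = β (θ a))
    {f : CovariantFamily α} (hf : f ∈ crossedProductSubalgebra α) :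
    reindex θ hθ f ∈ crossedProductSubalgebra β := by
  have hle : crossedProductSubalgebra α ≤
      (crossedProductSubalgebra β).comap (reindex θ hθ) := by
    refine StarSubalgebra.topologicalClosure_minimal ?_ ?_
    · refine StarAlgebra.adjoin_le ?_
      rintro _ (⟨a, rfl⟩ | rfl)
      · exact StarSubalgebra.le_topologicalClosure _
          (StarAlgebra.subset_adjoin ℂ _ (Or.inl ⟨θ a, rfl⟩))
      · exact StarSubalgebra.le_topologicalClosure _
          (StarAlgebra.subset_adjoin ℂ _ (Or.inr rfl))
    · exact (StarSubalgebra.isClosed_topologicalClosure _).preimage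
        (AddMonoidHomClass.continuous_of_bound (reindex θ hθ) 1 fun f =>
          (NonUnitalStarAlgHom.norm_apply_le (reindex θ hθ) f).trans_eq (one_mul _).symm)
  exact hle hf

/-- An equivariant isomorphism of C*-algebras induces an isomorphism of the crossed products. -/
def CrossedProduct.congr (θ : 𝒜 ≃⋆ₐ[ℂ] ℬ) (hθ : ∀ a, θ (α a) = β (θ a))
    (hθ' : ∀ b, θ.symm (β b) = α (θ.symm b)) : CrossedProduct α ≃⋆ₐ[ℂ] CrossedProduct β where
  toFun f := ⟨CovariantFamily.reindex θ hθ f.1, CovariantFamily.reindex_mem θ hθ f.2⟩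
  invFun f := ⟨CovariantFamily.reindex θ.symm hθ' f.1, CovariantFamily.reindex_mem θ.symm hθ' f.2⟩
  left_inv f := Subtype.ext (CovariantFamily.reindex_reindex θ hθ hθ' f.1)
  right_inv f := Subtype.ext (CovariantFamily.reindex_reindex θ.symm hθ' hθ f.1)
  map_mul' _ _ := rfl
  map_add' _ _ := rfl
  map_star' _ := rfl
  map_smul' _ _ := rfl

end CrossedProductFunctoriality

theorem corollary5 {N M : ℕ} (hN : 1 < N) (hM : 1 < M)
    (A : Matrix (Fin N) (Fin N) ℤ) (B : Matrix (Fin M) (Fin M) ℤ)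
    (hA01 : ∀ i j, A i j = 0 ∨ A i j = 1) (hB01 : ∀ i j, B i j = 0 ∨ B i j = 1)
    (hA : A.IsIrreducible) (hB : B.IsIrreducible)
    (hAI : ConditionI A) (hBI : ConditionI B)
    (hAB : StronglyContinuousOrbitEquivalent A B) :
    Nonempty (CrossedProduct (twoSidedShiftAut A) ≃⋆ₐ[ℂ] CrossedProduct (twoSidedShiftAut B)) := by
  obtain ⟨φ, hφ⟩ := hAB.exists_conjugacy
  -- The automorphisms compose with inverse shifts, so the conjugacy is needed for the inverses.
  have hsymm : ∀ y, (twoSidedShiftHomeo A).symm (φ.symm y) =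
      φ.symm ((twoSidedShiftHomeo B).symm y) := fun y => by
    rw [Homeomorph.symm_apply_eq, ← φ.symm_apply_apply (twoSidedShiftHomeo A _), hφ]
    simp
  have hsymm' : ∀ x, φ ((twoSidedShiftHomeo A).symm x) =
      (twoSidedShiftHomeo B).symm (φ x) := fun x => by
    rw [Homeomorph.eq_symm_apply, ← hφ]
    simp
  refine ⟨CrossedProduct.congr (φ.symm.compStarAlgEquiv' ℂ ℂ) (fun f => ?_) (fun f => ?_)⟩
  · ext y
    exact congrArg f (hsymm y)
  · ext x
    exact congrArg f (hsymm' x).symm
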